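/- **Theorem 3.16 (Spencer complex).** Let $\Bbbk$ be a commutative unital ring, $A$ an associative unital $\Bbbk$-algebra, and $(\Omega^\bullet_d,\wedge,d)$ an exterior algebra over $A$: a differential graded $\Bbbk$-algebra with $\Omega^0_d=A$, satisfying $d^2=0$ and the graded Leibniz rule, and generated by $A$ and $dA$. Write $\Omega^m_d$ also for the functor $\Omega^m_d\otimes_A-$ on the category ${}_A\mathrm{Mod}$ of left $A$-modules. Let $J^1_dA=(A\otimes_{\Bbbk}A)/N$, where $N=\{\sum_j a_j\otimes b_j : \sum_j a_jb_j=0,\ \sum_j a_j\,db_j=0\}$, with left action on the first factor and right action on the second, and let $J^1_d=J^1_dA\otimes_A-$, with prolongation $j^1_{d,E}(\xi)=[1\otimes1]\otimes_A\xi$. Let $\Omega^1_d\ltimes\Omega^2_d$ be the functor $E\mapsto(\Omega^1_d\oplus\Omega^2_d)\otimes_AE$, where $\Omega^1_d\oplus\Omega^2_d$ has the left action $\lambda(\alpha+\beta)=\lambda\alpha+(d\lambda\wedge\alpha+\lambda\beta)$ and the componentwise right action, and let $\widetilde{\mathfrak D}_E:J^1_dJ^1_dE\to(\Omega^1_d\ltimes\Omega^2_d)E$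 be the $A$-linear map $$[a\otimes b]\otimes_A[c\otimes e]\otimes_A\xi\longmapsto\big(a\,d(bc)\,e+da\wedge d(bc)\,e\big)\otimes_A\xi .$$ The holonomic jet functors $J^n_d:{}_A\mathrm{Mod}\to{}_A\mathrm{Mod}$ are defined by $J^0_d=\mathrm{id}$, $J^1_d$ as above, and, for $n\ge2$, $$J^n_d=\ker\big(\widetilde{\mathfrak D}_{J^{n-2}_d}\circ J^1_d(l^{1,n-2}_d):J^1_dJ^{n-1}_d\to(\Omega^1_d\ltimes\Omega^2_d)J^{n-2}_d\big),$$ with $l^{1,n-1}_d:J^n_d\to J^1_dJ^{n-1}_d$ the inclusion ($l^{1,0}_d=\mathrm{id}$). The prolongations $j^n_d:\mathrm{id}\to J^n_d$ are given by $j^0_d=\mathrm{id}$ and $l^{1,n-1}_d\circ j^n_d=j^1_{d,J^{n-1}_d}\circ j^{n-1}_d$. For $n\ge1$ and $m\ge0$, the Spencer operator $\mathcal S^{n,m}_d:\Omega^m_dJ^n_d\to\Omega^{m+1}_dJ^{n-1}_d$ is the natural transformation $$\omega\otimes_A\xi\longmapsto\sum_j d(\omega y_j)z_j\otimes_A\xi_j,\qquad\text{where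 } l^{1,n-1}_{d,E}(\xi)=\sum_j[y_j\otimes z_j]\otimes_A\xi_j .$$ The $j^n_d$ and $\mathcal S^{n,m}_d$ are natural transformations of functors from ${}_A\mathrm{Mod}$ to the category of $\Bbbk$-modules. Then for every $n\ge0$ the Spencer sequence $$0\to\mathrm{id}\xrightarrow{j^n_d}J^n_d\xrightarrow{\mathcal S^{n,0}_d}\Omega^1_dJ^{n-1}_d\xrightarrow{\mathcal S^{n-1,1}_d}\Omega^2_dJ^{n-2}_d\to\cdots\to\Omega^{n-1}_dJ^1_d\xrightarrow{\mathcal S^{1,n-1}_d}\Omega^n_d\to0$$ is a complex (where $\Omega^0_dJ^n_d$ is identified with $J^n_d$). That is, 1. $\mathcal S^{n,0}_d\circ j^n_d=0$ for all $n\ge1$; 2. $\mathcal S^{n-1,m+1}_d\circ\mathcal S^{n,m}_d=0$ for all $n\ge2$ and $m\ge0$. -/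

import Mathlib

open CategoryTheory TensorProduct MulOpposite

universe u v v₁ w

/-- An exterior algebra `(Ω^•, ∧, d)` over an associative unital `k`-algebra `A`: a differential
graded `k`-algebra `Ω = ⨁ₘ Ω^m` with `Ω^0 = A` (through `ι`), which is generated by `A` and `dA`.
The product of `Ω` is the wedge product. -/
structure ExteriorCalculus (k : Type w) (A : Type u) [CommRing k] [Ring A] [Algebra k A] where
  /-- the underlying algebra -/
  Ω : Type u
  [ring : Ring Ω]
  [algebra : Algebra k Ω]
  /-- the homogeneous components -/
  deg : ℕ → Submodule k Ω
  [gradedMonoid : SetLike.GradedMonoid deg]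
  isInternal : DirectSum.IsInternal deg
  /-- the identification of `A` with the component of degree zero -/
  ι : A →ₐ[k] Ω
  ι_injective : Function.Injective ι
  range_ι : LinearMap.range ι.toLinearMap = deg 0
  /-- the exterior derivative -/
  d : Ω →ₗ[k] Ω
  d_mem : ∀ {m : ℕ} {α : Ω}, α ∈ deg m → d α ∈ deg (m + 1)
  d_d : ∀ α : Ω, d (d α) = 0
  leibniz : ∀ {m : ℕ} {α : Ω}, α ∈ deg m → ∀ β : Ω, d (α * β) = d α * β + (-1) ^ m * (α * d β)
  generated : Algebra.adjoin k (Set.range ι ∪ Set.range fun a => d (ι a)) = ⊤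

attribute [instance] ExteriorCalculus.ring ExteriorCalculus.algebra
  ExteriorCalculus.gradedMonoid

noncomputable section

/-! ### The tensor product `M ⊗_A E` of an `A`-bimodule and a left `A`-module -/

section BalancedTensor

section Objects

variable (A : Type u) [Ring A]
  (M : Type u) [AddCommGroup M] [Module A M] [Module Aᵐᵒᵖ M]
  (E : Type v) [AddCommGroup E] [Module A E]

/-- The relations `m a ⊗ e = m ⊗ a e`. The right action of `A` on `M` is encoded as a left action
of the opposite ring. -/
def balancedRel : Submodule A (M ⊗[ℤ] E) :=
  Submodule.span A {t | ∃ (m : M) (a : A) (e : E), t = (op a • m) ⊗ₜ[ℤ] e - m ⊗ₜ[ℤ] (a • e)}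

/-- `M ⊗_A E`, a left `A`-module through the left action on `M`. -/
def BalancedTensor : Type (max u v) := (M ⊗[ℤ] E) ⧸ balancedRel A M E

instance : AddCommGroup (BalancedTensor A M E) :=
  inferInstanceAs (AddCommGroup ((M ⊗[ℤ] E) ⧸ balancedRel A M E))

instance : Module A (BalancedTensor A M E) :=
  inferInstanceAs (Module A ((M ⊗[ℤ] E) ⧸ balancedRel A M E))

end Objects

namespace BalancedTensor

variable {A : Type u} [Ring A]
  {M : Type u} [AddCommGroup M] [Module A M] [Module Aᵐᵒᵖ M]
  {E : Type v} [AddCommGroup E] [Module A E]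

variable (A M E) in
/-- The quotient map. -/
def mk : M ⊗[ℤ] E →ₗ[A] BalancedTensor A M E := (balancedRel A M E).mkQ

theorem mk_surjective : Function.Surjective (mk A M E) := Submodule.mkQ_surjective _

variable (A) in
/-- The element `m ⊗ e` of `M ⊗_A E`. -/
def tmul (m : M) (e : E) : BalancedTensor A M E := mk A M E (m ⊗ₜ[ℤ] e)

theorem add_tmul (m m' : M) (e : E) : tmul A (m + m') e = tmul A m e + tmul A m' e := by
  rw [tmul, TensorProduct.add_tmul, map_add]; rfl

theorem tmul_add (m : M) (e e' : E) : tmul A m (e + e') = tmul A m e + tmul A m e' := by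
  rw [tmul, TensorProduct.tmul_add, map_add]; rfl

theorem zero_tmul (e : E) : tmul A (0 : M) e = 0 := by
  rw [tmul, TensorProduct.zero_tmul, map_zero]

theorem tmul_zero (m : M) : tmul A m (0 : E) = 0 := by
  rw [tmul, TensorProduct.tmul_zero, map_zero]

theorem smul_tmul (a : A) (m : M) (e : E) : a • tmul A m e = tmul A (a • m) e := rfl

theorem op_smul_tmul (a : A) (m : M) (e : E) : tmul A (op a • m) e = tmul A m (a • e) := by
  rw [← sub_eq_zero, tmul, tmul, ← map_sub]
  exact (Submodule.Quotient.mk_eq_zero _).2 (Submodule.subset_span ⟨m, a, e, rfl⟩)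

theorem induction_on {p : BalancedTensor A M E → Prop} (x : BalancedTensor A M E)
    (zero : p 0) (tmul : ∀ m e, p (tmul A m e)) (add : ∀ x y, p x → p y → p (x + y)) : p x := by
  obtain ⟨t, rfl⟩ := mk_surjective x
  induction t using TensorProduct.induction_on with
  | zero => rw [map_zero]; exact zero
  | tmul m e => exact tmul m e
  | add s t hs ht => rw [map_add]; exact add _ _ hs ht

theorem addHom_ext {P : Type*} [AddCommGroup P] {f g : BalancedTensor A M E →+ P}
    (h : ∀ m e, f (tmul A m e) = g (tmul A m e)) : f = g := by
  ext x
  induction x using induction_on with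
  | zero => simp
  | tmul m e => exact h m e
  | add x y hx hy => rw [map_add, map_add, hx, hy]

section Lift

variable [SMulCommClass A Aᵐᵒᵖ M]

/-- The additive map on `M ⊗_A E` induced by an `A`-balanced biadditive map. -/
def lift {P : Type*} [AddCommGroup P] (f : M →+ E →+ P)
    (hf : ∀ m (a : A) e, f (op a • m) e = f m (a • e)) : BalancedTensor A M E →+ P :=
  QuotientAddGroup.lift (balancedRel A M E).toAddSubgroup
    (TensorProduct.liftAddHom f fun n m e => by simp) (by
      intro t ht
      induction ht using Submodule.closure_induction with
      | zero => exact map_zero _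
      | add x y _ _ hx hy => exact add_mem hx hy
      | smul_mem b x hx =>
        obtain ⟨m, a, e, rfl⟩ := hx
        rw [AddMonoidHom.mem_ker, smul_sub, TensorProduct.smul_tmul', TensorProduct.smul_tmul', map_sub,
          TensorProduct.liftAddHom_tmul, TensorProduct.liftAddHom_tmul, smul_comm, hf, sub_self])

theorem lift_tmul {P : Type*} [AddCommGroup P] (f : M →+ E →+ P)
    (hf : ∀ m (a : A) e, f (op a • m) e = f m (a • e)) (m : M) (e : E) :
    lift f hf (tmul A m e) = f m e := rfl

end Lift

variable (A M) in
/-- `id ⊗ φ : M ⊗_A E → M ⊗_A E'` for a left `A`-linear map `φ`. -/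
def mapRight [SMulCommClass A Aᵐᵒᵖ M] {E' : Type v₁} [AddCommGroup E'] [Module A E']
    (φ : E →ₗ[A] E') : BalancedTensor A M E →ₗ[A] BalancedTensor A M E' :=
  { lift (A := A) (M := M) (E := E) (P := BalancedTensor A M E')
      (AddMonoidHom.mk' (fun m => AddMonoidHom.mk' (fun e => tmul A m (φ e))
        fun e e' => by rw [map_add, tmul_add])
        fun m m' => by ext e; exact add_tmul m m' (φ e))
      (fun m a e => by
        change tmul A (op a • m) (φ e) = tmul A m (φ (a • e))
        rw [op_smul_tmul, map_smul]) with
    map_smul' := fun a x => by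
      change lift _ _ (a • x) = a • lift _ _ x
      induction x using induction_on with
      | zero => simp
      | tmul m e => rfl
      | add x y hx hy => rw [smul_add, map_add, map_add, hx, hy, smul_add] }

theorem mapRight_tmul [SMulCommClass A Aᵐᵒᵖ M] {E' : Type v₁} [AddCommGroup E'] [Module A E']
    (φ : E →ₗ[A] E') (m : M) (e : E) : mapRight A M φ (tmul A m e) = tmul A m (φ e) := rfl

variable (E) in
/-- `f ⊗ id : M ⊗_A E → M' ⊗_A E` for a right `A`-linear map `f`. -/
def mapLeft [SMulCommClass A Aᵐᵒᵖ M]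
    {M' : Type u} [AddCommGroup M'] [Module A M'] [Module Aᵐᵒᵖ M'] :
    (M →ₗ[Aᵐᵒᵖ] M') →+ (BalancedTensor A M E →+ BalancedTensor A M' E) :=
  AddMonoidHom.mk' (fun f =>
    lift (AddMonoidHom.mk' (fun m => AddMonoidHom.mk' (fun e => tmul A (f m) e)
        fun e e' => tmul_add _ _ _)
        fun m m' => by ext e; change tmul A (f (m + m')) e = _; rw [map_add]; exact add_tmul _ _ _)
      (fun m a e => by
        change tmul A (f (op a • m)) e = tmul A (f m) (a • e)
        rw [map_smul, op_smul_tmul]))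
    fun f g => addHom_ext fun m e => add_tmul (f m) (g m) e

theorem mapLeft_tmul [SMulCommClass A Aᵐᵒᵖ M]
    {M' : Type u} [AddCommGroup M'] [Module A M'] [Module Aᵐᵒᵖ M']
    (f : M →ₗ[Aᵐᵒᵖ] M') (m : M) (e : E) : mapLeft E f (tmul A m e) = tmul A (f m) e := rfl

end BalancedTensor

/-- The functor `M ⊗_A - : _A Mod ⥤ _A Mod` given by an `A`-bimodule `M`. -/
def tensorFunctor (A : Type u) [Ring A] (M : Type u) [AddCommGroup M] [Module A M]
    [Module Aᵐᵒᵖ M] [SMulCommClass A Aᵐᵒᵖ M] :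
    ModuleCat.{max u v} A ⥤ ModuleCat.{max u v} A where
  obj E := ModuleCat.of A (BalancedTensor A M E)
  map φ := ModuleCat.ofHom (BalancedTensor.mapRight A M φ.hom)
  map_id E := by
    ext x
    change BalancedTensor.mapRight A M _ x = x
    induction x using BalancedTensor.induction_on with
    | zero => simp
    | tmul m e => rfl
    | add x y hx hy => rw [map_add, hx, hy]
  map_comp φ ψ := by
    ext x
    change BalancedTensor.mapRight A M _ x =
      BalancedTensor.mapRight A M _ (BalancedTensor.mapRight A M _ x)
    induction x using BalancedTensor.induction_on with
    | zero => simp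
    | tmul m e => rfl
    | add x y hx hy => rw [map_add, map_add, map_add, hx, hy]

end BalancedTensor

/-! ### Kernels of natural transformations of endofunctors of `_A Mod` -/

section Kernel

variable {A : Type u} [Ring A] {F G : ModuleCat.{v} A ⥤ ModuleCat.{v} A}

/-- The objectwise kernel of a natural transformation. -/
def kerFunctor (f : F ⟶ G) : ModuleCat.{v} A ⥤ ModuleCat.{v} A where
  obj E := ModuleCat.of A (LinearMap.ker (f.app E).hom)
  map {E E'} φ := ModuleCat.ofHom ((F.map φ).hom.restrict fun x hx => by
    rw [LinearMap.mem_ker] at hx ⊢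
    have h := ConcreteCategory.congr_hom (f.naturality φ) x
    change (f.app E').hom ((F.map φ).hom x) = (G.map φ).hom ((f.app E).hom x) at h
    rw [h, hx, map_zero])
  map_id E := by
    ext x
    change (F.map (𝟙 E)).hom x.1 = x.1
    rw [F.map_id]; rfl
  map_comp φ ψ := by
    ext x
    change (F.map (φ ≫ ψ)).hom x.1 = (F.map ψ).hom ((F.map φ).hom x.1)
    rw [F.map_comp]; rfl

/-- The inclusion of the kernel. -/
def kerInclusion (f : F ⟶ G) : kerFunctor f ⟶ F where
  app E := ModuleCat.ofHom (LinearMap.ker (f.app E).hom).subtype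

end Kernel

namespace ExteriorCalculus

variable {k : Type w} {A : Type u} [CommRing k] [Ring A] [Algebra k A] (X : ExteriorCalculus k A)

/-! ### The bimodules `Ω^m` -/

/-- The space `Ω^m` of `m`-forms. -/
def Form (m : ℕ) : Type u := X.deg m

namespace Form

variable {X} {m : ℕ}

instance : AddCommGroup (X.Form m) := inferInstanceAs (AddCommGroup (X.deg m))

instance : Module k (X.Form m) := inferInstanceAs (Module k (X.deg m))

/-- A form, seen as an element of the exterior algebra. -/
def val (ω : X.Form m) : X.Ω := Subtype.val ω

@[ext] theorem ext {ω η : X.Form m} (h : ω.val = η.val) : ω = η := Subtype.ext h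

theorem val_mem (ω : X.Form m) : ω.val ∈ X.deg m := ω.2

variable (X) in
/-- A homogeneous element of the exterior algebra, seen as a form. -/
def mk (α : X.Ω) (h : α ∈ X.deg m) : X.Form m := ⟨α, h⟩

@[simp] theorem val_mk (α : X.Ω) (h : α ∈ X.deg m) : (mk X α h).val = α := rfl

@[simp] theorem val_zero : (0 : X.Form m).val = 0 := rfl

@[simp] theorem val_add (ω η : X.Form m) : (ω + η).val = ω.val + η.val := rfl

@[simp] theorem val_ksmul (c : k) (ω : X.Form m) : (c • ω).val = c • ω.val := rfl

theorem ι_mem (a : A) : X.ι a ∈ X.deg 0 := by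
  rw [← X.range_ι]; exact ⟨a, rfl⟩

/-- The left action `a ω = a ∧ ω`. -/
instance : SMul A (X.Form m) :=
  ⟨fun a ω => mk X (X.ι a * ω.val) (by
    simpa using SetLike.GradedMul.mul_mem (ι_mem a) ω.val_mem)⟩

/-- The right action `ω a = ω ∧ a`. -/
instance : SMul Aᵐᵒᵖ (X.Form m) :=
  ⟨fun a ω => mk X (ω.val * X.ι a.unop) (by
    simpa using SetLike.GradedMul.mul_mem ω.val_mem (ι_mem a.unop))⟩

@[simp] theorem val_smul (a : A) (ω : X.Form m) : (a • ω).val = X.ι a * ω.val := rfl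

@[simp] theorem val_op_smul (a : Aᵐᵒᵖ) (ω : X.Form m) : (a • ω).val = ω.val * X.ι a.unop := rfl

instance : Module A (X.Form m) where
  one_smul ω := by ext; simp
  mul_smul a b ω := by ext; simp [mul_assoc]
  smul_zero a := by ext; simp
  smul_add a ω η := by ext; simp [mul_add]
  add_smul a b ω := by ext; simp [add_mul]
  zero_smul ω := by ext; simp

instance : Module Aᵐᵒᵖ (X.Form m) where
  one_smul ω := by ext; simp
  mul_smul a b ω := by ext; simp [mul_assoc]
  smul_zero a := by ext; simp
  smul_add a ω η := by ext; simp [add_mul]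
  add_smul a b ω := by ext; simp [mul_add]
  zero_smul ω := by ext; simp

instance : SMulCommClass A Aᵐᵒᵖ (X.Form m) where
  smul_comm a b ω := by ext; simp [mul_assoc]

instance : IsScalarTower k A (X.Form m) where
  smul_assoc c a ω := by ext; simp

end Form

/-- The exterior derivative `d : Ω^m → Ω^{m+1}`. -/
def dForm {m : ℕ} : X.Form m →ₗ[k] X.Form (m + 1) where
  toFun ω := Form.mk X (X.d ω.val) (X.d_mem ω.val_mem)
  map_add' ω η := by ext; simp
  map_smul' c ω := by ext; simp

@[simp] theorem val_dForm {m : ℕ} (ω : X.Form m) : (X.dForm ω).val = X.d ω.val := rfl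

/-- The element `a` of `A`, seen as a form of degree zero. -/
def ofA : A →ₗ[k] X.Form 0 where
  toFun a := Form.mk X (X.ι a) (Form.ι_mem a)
  map_add' a b := by ext; simp
  map_smul' c a := by ext; simp

@[simp] theorem val_ofA (a : A) : (X.ofA a).val = X.ι a := rfl

/-- The derivation `d : A → Ω^1`. -/
def dA : A →ₗ[k] X.Form 1 where
  toFun a := Form.mk X (X.d (X.ι a)) (X.d_mem (Form.ι_mem a))
  map_add' a b := by ext; simp
  map_smul' c a := by ext; simp

@[simp] theorem val_dA (a : A) : (X.dA a).val = X.d (X.ι a) := rfl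

theorem d_ι_mul (a b : A) : X.d (X.ι (a * b)) = X.d (X.ι a) * X.ι b + X.ι a * X.d (X.ι b) := by
  rw [map_mul, X.leibniz (Form.ι_mem a)]; simp

/-! ### The bimodule `J^1 A` -/

/-- The map `A ⊗ A → Ω^1`, `a ⊗ b ↦ a db`. -/
def universalToForm : A ⊗[k] A →ₗ[k] X.Form 1 :=
  TensorProduct.lift (LinearMap.mk₂ k (fun a b => a • X.dA b)
    (fun a a' b => add_smul a a' _) (fun c a b => smul_assoc c a _)
    (fun a b b' => by rw [map_add, smul_add])
    (fun c a b => by ext; simp))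

@[simp] theorem universalToForm_tmul (a b : A) :
    X.universalToForm (a ⊗ₜ[k] b) = a • X.dA b := rfl

theorem mul'_smul (a : A) (t : A ⊗[k] A) :
    LinearMap.mul' k A (a • t) = a * LinearMap.mul' k A t := by
  induction t using TensorProduct.induction_on with
  | zero => simp
  | tmul b c => simp [TensorProduct.smul_tmul', mul_assoc]
  | add s t hs ht => rw [smul_add, map_add, map_add, hs, ht, mul_add]

theorem universalToForm_smul (a : A) (t : A ⊗[k] A) :
    X.universalToForm (a • t) = a • X.universalToForm t := by
  induction t using TensorProduct.induction_on with
  | zero => simp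
  | tmul b c => simp [TensorProduct.smul_tmul', mul_smul]
  | add s t hs ht => rw [smul_add, map_add, map_add, hs, ht, smul_add]

/-- The kernel of the quotient map from the universal one-forms
`Ω_u^1 = {∑ a_j ⊗ b_j | ∑ a_j b_j = 0}` to `Ω^1`, `∑ a_j ⊗ b_j ↦ ∑ a_j db_j`. -/
def jetRel : Submodule A (A ⊗[k] A) where
  carrier := {t | LinearMap.mul' k A t = 0 ∧ X.universalToForm t = 0}
  zero_mem' := by simp
  add_mem' := by
    rintro s t ⟨h1, h2⟩ ⟨h3, h4⟩
    exact ⟨by rw [map_add, h1, h3, add_zero], by rw [map_add, h2, h4, add_zero]⟩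
  smul_mem' := by
    rintro a t ⟨h1, h2⟩
    exact ⟨by rw [mul'_smul, h1, mul_zero], by rw [universalToForm_smul, h2, smul_zero]⟩

/-- `J^1 A`, the quotient of `A ⊗ A` by the kernel of `Ω_u^1 → Ω^1`. Its left action is on the
first factor. -/
def JetAlg : Type u := (A ⊗[k] A) ⧸ X.jetRel

namespace JetAlg

instance : AddCommGroup X.JetAlg := inferInstanceAs (AddCommGroup ((A ⊗[k] A) ⧸ X.jetRel))

instance : Module A X.JetAlg := inferInstanceAs (Module A ((A ⊗[k] A) ⧸ X.jetRel))

/-- The quotient map `A ⊗ A → J^1 A`, written `a ⊗ b ↦ [a ⊗ b]`. -/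
def mk : A ⊗[k] A →ₗ[A] X.JetAlg := X.jetRel.mkQ

theorem mk_surjective : Function.Surjective (mk X) := Submodule.mkQ_surjective _

theorem addHom_ext {P : Type*} [AddCommMonoid P] {f g : X.JetAlg →+ P}
    (h : ∀ a b, f (mk X (a ⊗ₜ b)) = g (mk X (a ⊗ₜ b))) : f = g := by
  ext x
  obtain ⟨t, rfl⟩ := mk_surjective X x
  induction t using TensorProduct.induction_on with
  | zero => simp
  | tmul a b => exact h a b
  | add s t hs ht => rw [map_add, map_add, map_add, hs, ht]

/-- The additive map on `J^1 A` induced by one on `A ⊗ A`. -/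
def lift {P : Type*} [AddCommGroup P] (f : A ⊗[k] A →+ P) (hf : ∀ t ∈ X.jetRel, f t = 0) :
    X.JetAlg →+ P :=
  QuotientAddGroup.lift X.jetRel.toAddSubgroup f hf

@[simp] theorem lift_mk {P : Type*} [AddCommGroup P] (f : A ⊗[k] A →+ P)
    (hf : ∀ t ∈ X.jetRel, f t = 0) (t : A ⊗[k] A) : lift X f hf (mk X t) = f t := rfl

/-- Right multiplication of the second factor of `A ⊗ A`. -/
def rightMul (c : A) : A ⊗[k] A →ₗ[A] A ⊗[k] A :=
  TensorProduct.AlgebraTensorModule.lTensor A A (LinearMap.mulRight k c)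

@[simp] theorem rightMul_tmul (a b c : A) :
    rightMul c (a ⊗ₜ[k] b) = a ⊗ₜ[k] (b * c) := rfl

theorem mul'_rightMul (c : A) (t : A ⊗[k] A) :
    LinearMap.mul' k A (rightMul c t) = LinearMap.mul' k A t * c := by
  induction t using TensorProduct.induction_on with
  | zero => simp
  | tmul a b => simp [mul_assoc]
  | add s t hs ht => rw [map_add, map_add, map_add, hs, ht, add_mul]

theorem universalToForm_rightMul (c : A) (t : A ⊗[k] A) :
    X.universalToForm (rightMul c t) =
      op c • X.universalToForm t + LinearMap.mul' k A t • X.dA c := by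
  induction t using TensorProduct.induction_on with
  | zero => simp
  | tmul a b =>
    ext
    simp only [rightMul_tmul, universalToForm_tmul, Form.val_smul, val_dA, d_ι_mul, Form.val_add,
      Form.val_op_smul, unop_op, LinearMap.mul'_apply, mul_add]
    simp only [map_mul, mul_assoc]
  | add s t hs ht =>
    rw [map_add, map_add, map_add, map_add, hs, ht, smul_add, add_smul]; abel

theorem rightMul_mem (c : A) (t : A ⊗[k] A) (ht : t ∈ X.jetRel) : rightMul c t ∈ X.jetRel := by
  obtain ⟨h1, h2⟩ := ht
  exact ⟨by rw [mul'_rightMul, h1, zero_mul],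
    by rw [universalToForm_rightMul, h1, h2, smul_zero, zero_smul, add_zero]⟩

/-- The right action `[a ⊗ b] c = [a ⊗ b c]`. -/
instance : SMul Aᵐᵒᵖ X.JetAlg :=
  ⟨fun c => X.jetRel.mapQ X.jetRel (rightMul c.unop) (rightMul_mem X c.unop)⟩

theorem op_smul_mk (c : Aᵐᵒᵖ) (t : A ⊗[k] A) : c • mk X t = mk X (rightMul c.unop t) := rfl

theorem op_smul_mk_tmul (c a b : A) :
    op c • mk X (a ⊗ₜ b) = mk X (a ⊗ₜ (b * c)) := rfl

theorem op_smul_add (c : Aᵐᵒᵖ) (x y : X.JetAlg) : c • (x + y) = c • x + c • y :=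
  map_add (X.jetRel.mapQ X.jetRel (rightMul c.unop) (rightMul_mem X c.unop)) x y

theorem induction_on {p : X.JetAlg → Prop} (x : X.JetAlg) (zero : p 0)
    (mk : ∀ a b, p (mk X (a ⊗ₜ b))) (add : ∀ x y, p x → p y → p (x + y)) : p x := by
  obtain ⟨t, rfl⟩ := mk_surjective X x
  induction t using TensorProduct.induction_on with
  | zero => simpa using zero
  | tmul a b => exact mk a b
  | add s t hs ht => rw [map_add]; exact add _ _ hs ht

instance : Module Aᵐᵒᵖ X.JetAlg where
  smul_zero c := map_zero (X.jetRel.mapQ X.jetRel (rightMul c.unop) (rightMul_mem X c.unop))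
  smul_add := op_smul_add X
  one_smul x := by
    obtain ⟨t, rfl⟩ := mk_surjective X x
    rw [op_smul_mk]
    congr 1
    induction t using TensorProduct.induction_on with
    | zero => simp
    | tmul a b => simp
    | add s t hs ht => rw [map_add, hs, ht]
  mul_smul c c' x := by
    obtain ⟨t, rfl⟩ := mk_surjective X x
    simp only [op_smul_mk]
    congr 1
    induction t using TensorProduct.induction_on with
    | zero => simp
    | tmul a b => simp [mul_assoc]
    | add s t hs ht => rw [map_add, map_add, map_add, hs, ht]
  add_smul c c' x := by
    obtain ⟨t, rfl⟩ := mk_surjective X x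
    simp only [op_smul_mk, ← map_add]
    congr 1
    induction t using TensorProduct.induction_on with
    | zero => simp
    | tmul a b => simp [mul_add, TensorProduct.tmul_add]
    | add s t hs ht => rw [map_add, map_add, map_add, hs, ht]; abel
  zero_smul x := by
    obtain ⟨t, rfl⟩ := mk_surjective X x
    rw [op_smul_mk, ← map_zero (mk X)]
    congr 1
    induction t using TensorProduct.induction_on with
    | zero => simp
    | tmul a b => simp
    | add s t hs ht => rw [map_add, hs, ht, add_zero]

instance : SMulCommClass A Aᵐᵒᵖ X.JetAlg where
  smul_comm a c x :=
    (map_smul (X.jetRel.mapQ X.jetRel (rightMul c.unop) (rightMul_mem X c.unop)) a x).symm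

/-- The projection `J^1 A → A`, `[a ⊗ b] ↦ a b`. -/
def proj : X.JetAlg →+ A :=
  lift X (LinearMap.mul' k A).toAddMonoidHom fun _ ht => ht.1

@[simp] theorem proj_mk (t : A ⊗[k] A) : proj X (mk X t) = LinearMap.mul' k A t := rfl

theorem proj_smul (a : A) (x : X.JetAlg) : proj X (a • x) = a * proj X x := by
  obtain ⟨t, rfl⟩ := mk_surjective X x
  rw [← map_smul, proj_mk, proj_mk, mul'_smul]

theorem proj_op_smul (c : Aᵐᵒᵖ) (x : X.JetAlg) : proj X (c • x) = proj X x * c.unop := by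
  obtain ⟨t, rfl⟩ := mk_surjective X x
  rw [op_smul_mk, proj_mk, proj_mk, mul'_rightMul]

/-- The left `A`-linear map `J^1 A → Ω^1`, `[a ⊗ b] ↦ a db`. -/
def leftForm : X.JetAlg →+ X.Form 1 :=
  lift X X.universalToForm.toAddMonoidHom fun _ ht => ht.2

@[simp] theorem leftForm_mk (t : A ⊗[k] A) : leftForm X (mk X t) = X.universalToForm t := rfl

theorem leftForm_smul (a : A) (x : X.JetAlg) : leftForm X (a • x) = a • leftForm X x := by
  obtain ⟨t, rfl⟩ := mk_surjective X x
  rw [← map_smul, leftForm_mk, leftForm_mk, universalToForm_smul]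

theorem leftForm_op_smul (c : A) (x : X.JetAlg) :
    leftForm X (op c • x) = op c • leftForm X x + proj X x • X.dA c := by
  obtain ⟨t, rfl⟩ := mk_surjective X x
  rw [op_smul_mk, leftForm_mk, leftForm_mk, proj_mk, unop_op, universalToForm_rightMul]

end JetAlg

/-! ### The bimodule `Ω^1 ⋉ Ω^2` and the map `D̃` -/

/-- The bimodule `Ω^1 ⋉ Ω^2`: the space `Ω^1 ⊕ Ω^2` with the left action
`a (α + β) = a α + (da ∧ α + a β)` and the componentwise right action. -/
def SemiForm : Type u := X.Form 1 × X.Form 2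

namespace SemiForm

variable {X}

instance : AddCommGroup X.SemiForm := inferInstanceAs (AddCommGroup (X.Form 1 × X.Form 2))

/-- The component of degree one. -/
def one : X.SemiForm →+ X.Form 1 := AddMonoidHom.fst _ _

/-- The component of degree two. -/
def two : X.SemiForm →+ X.Form 2 := AddMonoidHom.snd _ _

variable (X) in
/-- The pair `α + β`. -/
def mk (α : X.Form 1) (β : X.Form 2) : X.SemiForm := (α, β)

@[simp] theorem one_mk (α : X.Form 1) (β : X.Form 2) : (mk X α β).one = α := rfl

@[simp] theorem two_mk (α : X.Form 1) (β : X.Form 2) : (mk X α β).two = β := rfl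

@[ext] theorem ext {x y : X.SemiForm} (h1 : x.one = y.one) (h2 : x.two = y.two) : x = y :=
  Prod.ext h1 h2

/-- The product `Ω^1 × Ω^1 → Ω^2`. -/
def wedge (α β : X.Form 1) : X.Form 2 :=
  Form.mk X (α.val * β.val) (SetLike.GradedMul.mul_mem α.val_mem β.val_mem)

@[simp] theorem val_wedge (α β : X.Form 1) : (wedge α β).val = α.val * β.val := rfl

instance : SMul A X.SemiForm :=
  ⟨fun a x => mk X (a • x.one) (wedge (X.dA a) x.one + a • x.two)⟩

instance : SMul Aᵐᵒᵖ X.SemiForm := ⟨fun a x => mk X (a • x.one) (a • x.two)⟩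

@[simp] theorem one_smul' (a : A) (x : X.SemiForm) : (a • x).one = a • x.one := rfl

@[simp] theorem two_smul' (a : A) (x : X.SemiForm) :
    (a • x).two = wedge (X.dA a) x.one + a • x.two := rfl

@[simp] theorem one_op_smul (a : Aᵐᵒᵖ) (x : X.SemiForm) : (a • x).one = a • x.one := rfl

@[simp] theorem two_op_smul (a : Aᵐᵒᵖ) (x : X.SemiForm) : (a • x).two = a • x.two := rfl

theorem d_ι_one : X.d (X.ι 1) = 0 := by
  have h := X.d_ι_mul 1 1
  rw [mul_one, map_one, mul_one, one_mul] at h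
  rw [map_one]
  simpa using h

instance : Module A X.SemiForm where
  one_smul x := by ext <;> simp [d_ι_one, -map_one]
  mul_smul a b x := by
    ext
    · simp [mul_assoc]
    · simp only [two_smul', one_smul', Form.val_add, val_wedge, val_dA, d_ι_mul, Form.val_smul,
        mul_add, add_mul]
      simp only [map_mul, mul_assoc, add_assoc]
  smul_zero a := by ext <;> simp
  smul_add a x y := by
    ext
    · simp
    · simp [mul_add]; abel
  add_smul a b x := by
    ext
    · simp [add_mul]
    · simp [add_mul]; abel
  zero_smul x := by ext <;> simp

instance : Module Aᵐᵒᵖ X.SemiForm where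
  one_smul x := by ext <;> simp
  mul_smul a b x := by ext <;> simp [mul_assoc]
  smul_zero a := by ext <;> simp
  smul_add a x y := by ext <;> simp [add_mul]
  add_smul a b x := by ext <;> simp [mul_add]
  zero_smul x := by ext <;> simp

instance : SMulCommClass A Aᵐᵒᵖ X.SemiForm where
  smul_comm a b x := by ext <;> simp [mul_assoc, add_mul]

end SemiForm

namespace JetAlg

/-- The right `A`-linear map `J^1 A → Ω^1`, `[a ⊗ b] ↦ (da) b`. -/
def rightForm : X.JetAlg →ₗ[Aᵐᵒᵖ] X.Form 1 where
  toFun x := X.dA (proj X x) - leftForm X x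
  map_add' x y := by simp only [map_add]; abel
  map_smul' c x := by
    induction c using MulOpposite.rec' with | _ c =>
    ext
    simp only [proj_op_smul, leftForm_op_smul, unop_op, RingHom.id_apply]
    simp only [sub_eq_add_neg, Form.val_add, val_dA, d_ι_mul, Form.val_op_smul, add_mul, unop_op]
    have hneg : ∀ η : X.Form 1, (-η).val = -η.val := fun _ => rfl
    simp only [hneg, Form.val_add, Form.val_op_smul, Form.val_smul, val_dA, unop_op, neg_mul]
    abel

@[simp] theorem val_rightForm_mk_tmul (a b : A) :
    (rightForm X (mk X (a ⊗ₜ b))).val = X.d (X.ι a) * X.ι b := by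
  have h : (rightForm X (mk X (a ⊗ₜ b))).val = X.d (X.ι (a * b)) - X.ι a * X.d (X.ι b) := rfl
  rw [h, d_ι_mul]; abel

/-- For `x ∈ J^1 A`, the right `A`-linear map `D̃(x ⊗ -) : J^1 A → Ω^1 ⋉ Ω^2`; on generators
`D̃([a ⊗ b] ⊗ [c ⊗ e]) = a d(b c) e + da ∧ d(b c) e`, see `one_dTildeAlg` and `two_dTildeAlg`. -/
def dTildeAlg : X.JetAlg →+ X.JetAlg →ₗ[Aᵐᵒᵖ] X.SemiForm :=
  AddMonoidHom.mk'
    (fun x =>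
      { toFun := fun y => SemiForm.mk X
          (op (proj X y) • leftForm X x + proj X x • rightForm X y)
          (op (proj X y) • X.dForm (leftForm X x) +
            SemiForm.wedge (rightForm X x) (rightForm X y))
        map_add' := fun y z => by
          ext
          · simp [mul_add]; abel
          · simp [mul_add]; abel
        map_smul' := fun c y => by
          ext <;> simp [proj_op_smul, mul_assoc, add_mul] })
    (fun x y => by
      ext z
      · simp [mul_add, add_mul]; abel
      · simp [mul_add, add_mul]; abel)

theorem dTildeAlg_apply (x y : X.JetAlg) : dTildeAlg X x y = SemiForm.mk X
    (op (proj X y) • leftForm X x + proj X x • rightForm X y)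
    (op (proj X y) • X.dForm (leftForm X x) +
      SemiForm.wedge (rightForm X x) (rightForm X y)) := rfl

theorem one_dTildeAlg (a b c e : A) :
    (dTildeAlg X (mk X (a ⊗ₜ b)) (mk X (c ⊗ₜ e))).one.val =
      X.ι a * X.d (X.ι (b * c)) * X.ι e := by
  rw [dTildeAlg_apply]
  simp only [SemiForm.one_mk, Form.val_add, Form.val_smul, Form.val_op_smul, unop_op, proj_mk,
    leftForm_mk, universalToForm_tmul, LinearMap.mul'_apply, val_dA, val_rightForm_mk_tmul,
    d_ι_mul]
  simp only [map_mul, mul_add, add_mul, mul_assoc]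

theorem two_dTildeAlg (a b c e : A) :
    (dTildeAlg X (mk X (a ⊗ₜ b)) (mk X (c ⊗ₜ e))).two.val =
      X.d (X.ι a) * X.d (X.ι (b * c)) * X.ι e := by
  have h : X.d (X.ι a * X.d (X.ι b)) = X.d (X.ι a) * X.d (X.ι b) := by
    rw [X.leibniz (Form.ι_mem a), X.d_d]; simp
  rw [dTildeAlg_apply]
  simp only [SemiForm.two_mk, Form.val_add, Form.val_smul, Form.val_op_smul, unop_op, proj_mk,
    leftForm_mk, universalToForm_tmul, LinearMap.mul'_apply, val_dA, val_rightForm_mk_tmul,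
    d_ι_mul, val_dForm, SemiForm.val_wedge, h]
  simp only [map_mul, mul_add, add_mul, mul_assoc]

theorem dTildeAlg_op_smul (x y : X.JetAlg) (a : A) :
    dTildeAlg X (op a • x) y = dTildeAlg X x (a • y) := by
  refine DFunLike.congr_fun (f := (dTildeAlg X (op a • x)).toAddMonoidHom)
    (g := (dTildeAlg X x).toAddMonoidHom.comp (DistribSMul.toAddMonoidHom X.JetAlg a)) ?_ y
  refine addHom_ext X fun c e => ?_
  change dTildeAlg X (op a • x) (mk X (c ⊗ₜ e)) = dTildeAlg X x (mk X ((a * c) ⊗ₜ e))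
  induction x using induction_on with
  | zero => rw [smul_zero, map_zero]; rfl
  | add x x' h h' =>
    rw [smul_add, map_add, map_add, LinearMap.add_apply, LinearMap.add_apply, h, h']
  | mk b b' =>
    rw [op_smul_mk_tmul]
    ext
    · rw [one_dTildeAlg, one_dTildeAlg, mul_assoc b' a c]
    · rw [two_dTildeAlg, two_dTildeAlg, mul_assoc b' a c]

theorem dTildeAlg_smul (a : A) (x y : X.JetAlg) :
    dTildeAlg X (a • x) y = a • dTildeAlg X x y := by
  induction x using induction_on with
  | zero => rw [smul_zero, map_zero, LinearMap.zero_apply, smul_zero]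
  | add x x' h h' =>
    rw [smul_add, map_add, map_add, LinearMap.add_apply, LinearMap.add_apply, h, h', smul_add]
  | mk b b' =>
    induction y using induction_on with
    | zero => rw [map_zero, map_zero, smul_zero]
    | add y y' h h' => rw [map_add, map_add, h, h', smul_add]
    | mk c e =>
      have h : a • mk X (b ⊗ₜ b') = mk X ((a * b) ⊗ₜ b') := rfl
      rw [h]
      ext
      · rw [one_dTildeAlg, SemiForm.one_smul', Form.val_smul, one_dTildeAlg]
        simp only [map_mul, mul_assoc]
      · rw [two_dTildeAlg, SemiForm.two_smul', Form.val_add, SemiForm.val_wedge, Form.val_smul,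
          one_dTildeAlg, two_dTildeAlg, d_ι_mul X a b]
        simp only [val_dA, add_mul, mul_assoc]

end JetAlg

section Components

variable (E : Type v) [AddCommGroup E] [Module A E]

/-- `D̃_E : J^1 J^1 E → (Ω^1 ⋉ Ω^2) E`, with
`[a ⊗ b] ⊗ [c ⊗ e] ⊗ ξ ↦ (a d(b c) e + da ∧ d(b c) e) ⊗ ξ`. -/
def dTilde : BalancedTensor A X.JetAlg (BalancedTensor A X.JetAlg E) →ₗ[A]
    BalancedTensor A X.SemiForm E :=
  { BalancedTensor.lift (A := A) ((BalancedTensor.mapLeft E).comp (JetAlg.dTildeAlg X))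
      (fun x a y => by
        induction y using BalancedTensor.induction_on with
        | zero => rw [map_zero, smul_zero, map_zero]
        | add y z hy hz => rw [map_add, hy, hz, smul_add, map_add]
        | tmul y e =>
          rw [BalancedTensor.smul_tmul]
          change BalancedTensor.tmul A (JetAlg.dTildeAlg X (op a • x) y) e =
            BalancedTensor.tmul A (JetAlg.dTildeAlg X x (a • y)) e
          rw [JetAlg.dTildeAlg_op_smul]) with
    map_smul' := fun a x => by
      change BalancedTensor.lift _ _ (a • x) = a • BalancedTensor.lift _ _ x
      induction x using BalancedTensor.induction_on with
      | zero => simp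
      | add x y hx hy => rw [smul_add, map_add, map_add, hx, hy, smul_add]
      | tmul x y =>
        rw [BalancedTensor.smul_tmul, BalancedTensor.lift_tmul, BalancedTensor.lift_tmul]
        induction y using BalancedTensor.induction_on with
        | zero => rw [map_zero, map_zero, smul_zero]
        | add y z hy hz => rw [map_add, map_add, hy, hz, smul_add]
        | tmul y e =>
          change BalancedTensor.tmul A (JetAlg.dTildeAlg X (a • x) y) e =
            BalancedTensor.tmul A (a • JetAlg.dTildeAlg X x y) e
          rw [JetAlg.dTildeAlg_smul] }

theorem dTilde_tmul (x y : X.JetAlg) (e : E) :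
    X.dTilde E (BalancedTensor.tmul A x (BalancedTensor.tmul A y e)) =
      BalancedTensor.tmul A (JetAlg.dTildeAlg X x y) e := rfl

variable {E} in
theorem dTilde_naturality {E' : Type v} [AddCommGroup E'] [Module A E'] (φ : E →ₗ[A] E')
    (x : BalancedTensor A X.JetAlg (BalancedTensor A X.JetAlg E)) :
    X.dTilde E' (BalancedTensor.mapRight A _ (BalancedTensor.mapRight A _ φ) x) =
      BalancedTensor.mapRight A _ φ (X.dTilde E x) := by
  induction x using BalancedTensor.induction_on with
  | zero => simp
  | add x y hx hy => rw [map_add, map_add, map_add, map_add, hx, hy]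
  | tmul x y =>
    rw [BalancedTensor.mapRight_tmul]
    induction y using BalancedTensor.induction_on with
    | zero => simp [BalancedTensor.tmul_zero]
    | add y z hy hz =>
      rw [map_add, BalancedTensor.tmul_add, BalancedTensor.tmul_add, map_add, map_add, map_add,
        hy, hz]
    | tmul y e => rfl

end Components

/-! ### The Spencer operators on `Ω^m J^1` -/

/-- For `ω ∈ Ω^m`, the map `A ⊗ A → Ω^{m+1}`, `y ⊗ z ↦ d(ω y) z`. -/
def spencerUniv {m : ℕ} (ω : X.Form m) : A ⊗[k] A →ₗ[k] X.Form (m + 1) :=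
  TensorProduct.lift (LinearMap.mk₂ k (fun y z => op z • X.dForm (op y • ω))
    (fun y y' z => by rw [MulOpposite.op_add, add_smul, map_add, smul_add])
    (fun c y z => by ext; simp)
    (fun y z z' => by rw [MulOpposite.op_add, add_smul])
    (fun c y z => by ext; simp))

theorem spencerUniv_tmul {m : ℕ} (ω : X.Form m) (y z : A) :
    X.spencerUniv ω (y ⊗ₜ z) = op z • X.dForm (op y • ω) := rfl

theorem val_spencerUniv {m : ℕ} (ω : X.Form m) (t : A ⊗[k] A) :
    (X.spencerUniv ω t).val = X.d ω.val * X.ι (LinearMap.mul' k A t) +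
      (-1) ^ m * (ω.val * (X.d (X.ι (LinearMap.mul' k A t)) - (X.universalToForm t).val)) := by
  induction t using TensorProduct.induction_on with
  | zero => simp
  | add s t hs ht =>
    simp only [map_add, Form.val_add, hs, ht, mul_add, mul_sub]; abel
  | tmul y z =>
    rw [spencerUniv_tmul]
    simp only [Form.val_op_smul, val_dForm, unop_op, X.leibniz ω.val_mem, LinearMap.mul'_apply,
      universalToForm_tmul, Form.val_smul, val_dA, d_ι_mul]
    simp only [map_mul, add_mul, mul_assoc, add_sub_cancel_right]

/-- For `ω ∈ Ω^m`, the map `J^1 A → Ω^{m+1}`, `[y ⊗ z] ↦ d(ω y) z`. -/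
def spencerAlgHom {m : ℕ} (ω : X.Form m) : X.JetAlg →+ X.Form (m + 1) :=
  JetAlg.lift X (X.spencerUniv ω).toAddMonoidHom fun t ht => by
    ext
    change (X.spencerUniv ω t).val = 0
    rw [val_spencerUniv, ht.1, ht.2]; simp

theorem spencerAlgHom_mk_tmul {m : ℕ} (ω : X.Form m) (y z : A) :
    X.spencerAlgHom ω (JetAlg.mk X (y ⊗ₜ z)) = op z • X.dForm (op y • ω) := rfl

/-- The map `[y ⊗ z] ↦ d(ω y) z` as a right `A`-linear map, additive in `ω`. -/
def spencerAlg (m : ℕ) : X.Form m →+ X.JetAlg →ₗ[Aᵐᵒᵖ] X.Form (m + 1) :=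
  AddMonoidHom.mk'
    (fun ω =>
      { toFun := X.spencerAlgHom ω
        map_add' := map_add _
        map_smul' := fun c x => by
          induction c using MulOpposite.rec' with | _ c =>
          induction x using JetAlg.induction_on with
          | zero => simp
          | add x y hx hy => rw [smul_add, map_add, map_add, hx, hy, smul_add]
          | mk y z =>
            rw [JetAlg.op_smul_mk_tmul, spencerAlgHom_mk_tmul, spencerAlgHom_mk_tmul, op_mul,
              mul_smul]; rfl })
    (fun ω η => by
      ext1 x
      change X.spencerAlgHom (ω + η) x = X.spencerAlgHom ω x + X.spencerAlgHom η x
      induction x using JetAlg.induction_on with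
      | zero => simp
      | add x y hx hy => rw [map_add, map_add, map_add, hx, hy]; abel
      | mk y z => simp only [spencerAlgHom_mk_tmul, smul_add, map_add])

theorem spencerAlg_mk_tmul {m : ℕ} (ω : X.Form m) (y z : A) :
    X.spencerAlg m ω (JetAlg.mk X (y ⊗ₜ z)) = op z • X.dForm (op y • ω) := rfl

theorem spencerAlg_op_smul {m : ℕ} (ω : X.Form m) (a : A) (x : X.JetAlg) :
    X.spencerAlg m (op a • ω) x = X.spencerAlg m ω (a • x) := by
  induction x using JetAlg.induction_on with
  | zero => simp
  | add x y hx hy => rw [smul_add, map_add, map_add, hx, hy]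
  | mk y z =>
    have h : a • JetAlg.mk X (y ⊗ₜ z) = JetAlg.mk X ((a * y) ⊗ₜ z) := rfl
    rw [h, spencerAlg_mk_tmul, spencerAlg_mk_tmul, op_mul, mul_smul]

theorem spencerAlg_algebraMap_smul {m : ℕ} (c : k) (ω : X.Form m) (x : X.JetAlg) :
    X.spencerAlg m (algebraMap k A c • ω) x = algebraMap k A c • X.spencerAlg m ω x := by
  induction x using JetAlg.induction_on with
  | zero => simp
  | add x y hx hy => rw [map_add, map_add, hx, hy, smul_add]
  | mk y z =>
    rw [spencerAlg_mk_tmul, spencerAlg_mk_tmul]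
    ext
    simp

section Components

variable (E : Type v) [AddCommGroup E] [Module A E]

/-- The Spencer operator `S^{1,m}_E : Ω^m J^1 E → Ω^{m+1} E`,
`ω ⊗ [y ⊗ z] ⊗ ξ ↦ d(ω y) z ⊗ ξ`. -/
def spencerOneHom (m : ℕ) :
    BalancedTensor A (X.Form m) (BalancedTensor A X.JetAlg E) →+
      BalancedTensor A (X.Form (m + 1)) E :=
  BalancedTensor.lift ((BalancedTensor.mapLeft E).comp (X.spencerAlg m)) fun ω a y => by
    induction y using BalancedTensor.induction_on with
    | zero => rw [map_zero, smul_zero, map_zero]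
    | add y z hy hz => rw [map_add, hy, hz, smul_add, map_add]
    | tmul y e =>
      rw [BalancedTensor.smul_tmul]
      change BalancedTensor.tmul A (X.spencerAlg m (op a • ω) y) e =
        BalancedTensor.tmul A (X.spencerAlg m ω (a • y)) e
      rw [spencerAlg_op_smul]

theorem spencerOneHom_tmul {m : ℕ} (ω : X.Form m) (x : X.JetAlg) (e : E) :
    X.spencerOneHom E m (BalancedTensor.tmul A ω (BalancedTensor.tmul A x e)) =
      BalancedTensor.tmul A (X.spencerAlg m ω x) e := rfl

theorem spencerOneHom_mk_tmul {m : ℕ} (ω : X.Form m) (y z : A) (e : E) :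
    X.spencerOneHom E m (BalancedTensor.tmul A ω
        (BalancedTensor.tmul A (JetAlg.mk X (y ⊗ₜ z)) e)) =
      BalancedTensor.tmul A (op z • X.dForm (op y • ω)) e := rfl

theorem spencerOneHom_algebraMap_smul {m : ℕ} (c : k)
    (x : BalancedTensor A (X.Form m) (BalancedTensor A X.JetAlg E)) :
    X.spencerOneHom E m (algebraMap k A c • x) = algebraMap k A c • X.spencerOneHom E m x := by
  induction x using BalancedTensor.induction_on with
  | zero => simp
  | add x y hx hy => rw [smul_add, map_add, map_add, hx, hy, smul_add]
  | tmul ω y =>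
    rw [BalancedTensor.smul_tmul]
    induction y using BalancedTensor.induction_on with
    | zero => rw [BalancedTensor.tmul_zero, BalancedTensor.tmul_zero, map_zero, smul_zero]
    | add y z hy hz =>
      rw [BalancedTensor.tmul_add, BalancedTensor.tmul_add, map_add, map_add, hy, hz, smul_add]
    | tmul y e =>
      rw [spencerOneHom_tmul, spencerOneHom_tmul, spencerAlg_algebraMap_smul]; rfl

variable {E} in
theorem spencerOneHom_naturality {E' : Type v} [AddCommGroup E'] [Module A E'] (φ : E →ₗ[A] E') {m : ℕ}
    (x : BalancedTensor A (X.Form m) (BalancedTensor A X.JetAlg E)) :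
    X.spencerOneHom E' m (BalancedTensor.mapRight A _ (BalancedTensor.mapRight A _ φ) x) =
      BalancedTensor.mapRight A _ φ (X.spencerOneHom E m x) := by
  induction x using BalancedTensor.induction_on with
  | zero => simp
  | add x y hx hy => rw [map_add, map_add, map_add, map_add, hx, hy]
  | tmul x y =>
    rw [BalancedTensor.mapRight_tmul]
    induction y using BalancedTensor.induction_on with
    | zero => simp [BalancedTensor.tmul_zero]
    | add y z hy hz =>
      rw [map_add, BalancedTensor.tmul_add, BalancedTensor.tmul_add, map_add, map_add, map_add,
        hy, hz]
    | tmul y e => rfl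

theorem tmul_one_algebraMap_smul (c : k) (e : E) :
    BalancedTensor.tmul A (JetAlg.mk X (1 ⊗ₜ 1)) (algebraMap k A c • e) =
      algebraMap k A c • BalancedTensor.tmul A (JetAlg.mk X (1 ⊗ₜ 1)) e := by
  rw [BalancedTensor.smul_tmul, ← BalancedTensor.op_smul_tmul, JetAlg.op_smul_mk_tmul,
    ← map_smul, TensorProduct.smul_tmul', one_mul, smul_eq_mul, mul_one,
    Algebra.algebraMap_eq_smul_one, TensorProduct.tmul_smul, TensorProduct.smul_tmul']

end Components

/-! ### Functors and natural transformations -/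

/-- The forgetful functor `_A Mod ⥤ Mod_k`. -/
abbrev forgetful (k : Type w) (A : Type u) [CommRing k] [Ring A] [Algebra k A] :
    ModuleCat.{max u v} A ⥤ ModuleCat.{max u v} k :=
  ModuleCat.restrictScalars.{max u v} (algebraMap k A)

/-- The functor `Ω^m ⊗_A -`. -/
abbrev formFunctor (m : ℕ) : ModuleCat.{max u v} A ⥤ ModuleCat.{max u v} A :=
  tensorFunctor.{u, v} A (X.Form m)

/-- The 1-jet functor `J^1 = J^1 A ⊗_A -`. -/
abbrev jetOne : ModuleCat.{max u v} A ⥤ ModuleCat.{max u v} A :=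
  tensorFunctor.{u, v} A X.JetAlg

/-- The functor `Ω^1 ⋉ Ω^2`. -/
abbrev semiFunctor : ModuleCat.{max u v} A ⥤ ModuleCat.{max u v} A :=
  tensorFunctor.{u, v} A X.SemiForm

/-- The `A`-linear natural transformation `D̃ : J^1 J^1 ⟶ Ω^1 ⋉ Ω^2`. -/
def dTildeNat : X.jetOne ⋙ X.jetOne ⟶ semiFunctor.{u, v, w} X where
  app E := ModuleCat.ofHom (X.dTilde E)
  naturality E E' φ := by
    ext x
    exact X.dTilde_naturality φ.hom x

/-- The 1-jet prolongation `j^1_E : E → J^1 E`, `ξ ↦ [1 ⊗ 1] ⊗ ξ`, a natural transformation of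
functors `_A Mod ⥤ Mod_k`. -/
def prolongOne : forgetful.{u, v, w} k A ⟶ X.jetOne ⋙ forgetful.{u, v, w} k A where
  app E := ModuleCat.ofHom
    (X := (forgetful.{u, v, w} k A).obj E) (Y := (forgetful.{u, v, w} k A).obj (X.jetOne.obj E))
    { toFun := fun e => BalancedTensor.tmul A (JetAlg.mk X (1 ⊗ₜ 1)) (E := E) e
      map_add' := fun e e' => BalancedTensor.tmul_add (A := A) (E := E) _ e e'
      map_smul' := fun c e => X.tmul_one_algebraMap_smul E c e }
  naturality E E' φ := rfl

/-- The Spencer operators `S^{1,m} : Ω^m J^1 ⟶ Ω^{m+1}`, as natural transformations of functors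
`_A Mod ⥤ Mod_k`. -/
def spencerOne (m : ℕ) : (X.jetOne ⋙ X.formFunctor m) ⋙ forgetful.{u, v, w} k A ⟶
    X.formFunctor (m + 1) ⋙ forgetful.{u, v, w} k A where
  app E := ModuleCat.ofHom
    (X := (forgetful.{u, v, w} k A).obj ((X.formFunctor m).obj (X.jetOne.obj E)))
    (Y := (forgetful.{u, v, w} k A).obj ((X.formFunctor (m + 1)).obj E))
    { X.spencerOneHom E m with
      map_smul' := fun c x => X.spencerOneHom_algebraMap_smul E c x }
  naturality E E' φ := by
    ext x
    exact X.spencerOneHom_naturality φ.hom x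

/-- The canonical natural map `E → Ω^0 ⊗_A E`, `ξ ↦ 1 ⊗ ξ`. -/
def toFormZero : 𝟭 (ModuleCat.{max u v} A) ⟶ formFunctor.{u, v, w} X 0 where
  app E := ModuleCat.ofHom
    { toFun := fun e => BalancedTensor.tmul A (X.ofA 1) e
      map_add' := fun e e' => BalancedTensor.tmul_add _ e e'
      map_smul' := fun a e => by
        rw [← BalancedTensor.op_smul_tmul, RingHom.id_apply, BalancedTensor.smul_tmul]
        congr 1
        ext; simp }
  naturality E E' φ := rfl

/-- The map `E → Ω^0 ⊗_A E`, `ξ ↦ 1 ⊗ ξ`, is bijective. -/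
theorem tmul_ofA_one_bijective (E : Type v) [AddCommGroup E] [Module A E] :
    Function.Bijective fun e : E => BalancedTensor.tmul A (X.ofA 1) e := by
  have hb : Function.Bijective X.ofA := by
    refine ⟨fun a b h => X.ι_injective (congrArg Form.val h), fun ω => ?_⟩
    have h := ω.val_mem
    rw [← X.range_ι] at h
    obtain ⟨a, ha⟩ := h
    exact ⟨a, Form.ext ha⟩
  constructor
  · let r : X.Form 0 ≃+ A := (AddEquiv.ofBijective X.ofA hb).symm
    have hr : ∀ a, r (X.ofA a) = a := fun a => (AddEquiv.ofBijective X.ofA hb).symm_apply_apply a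
    let f : X.Form 0 →+ E →+ E := AddMonoidHom.mk'
      (fun ω => DistribSMul.toAddMonoidHom E (r ω))
      (fun ω η => by ext e; simp [add_smul])
    have hf : ∀ ω (a : A) e, f (op a • ω) e = f ω (a • e) := by
      intro ω a e
      obtain ⟨b, rfl⟩ := hb.2 ω
      have h : op a • X.ofA b = X.ofA (b * a) := by ext; simp
      change r (op a • X.ofA b) • e = r (X.ofA b) • a • e
      rw [h, hr, hr, mul_smul]
    intro e e' h
    have h' := congrArg (BalancedTensor.lift f hf) h
    change r (X.ofA 1) • e = r (X.ofA 1) • e' at h'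
    rwa [hr, one_smul, one_smul] at h'
  · intro x
    induction x using BalancedTensor.induction_on with
    | zero => exact ⟨0, BalancedTensor.tmul_zero _⟩
    | add x y hx hy =>
      obtain ⟨e, rfl⟩ := hx
      obtain ⟨e', rfl⟩ := hy
      exact ⟨e + e', BalancedTensor.tmul_add _ _ _⟩
    | tmul ω e =>
      obtain ⟨a, rfl⟩ := hb.2 ω
      refine ⟨a • e, ?_⟩
      change BalancedTensor.tmul A (X.ofA 1) (a • e) = _
      rw [← BalancedTensor.op_smul_tmul]
      congr 1
      ext; simp

/-! ### The holonomic jet functors -/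

/-- Two consecutive jet functors `P = J^n` and `Q = J^{n+1}`, with the natural transformation
`l = l^{1,n} : J^{n+1} ⟶ J^1 J^n` and the prolongations `j^n`, `j^{n+1}`. -/
structure JetStage where
  P : ModuleCat.{max u v} A ⥤ ModuleCat.{max u v} A
  Q : ModuleCat.{max u v} A ⥤ ModuleCat.{max u v} A
  l : Q ⟶ P ⋙ X.jetOne
  jP : forgetful.{u, v, w} k A ⟶ P ⋙ forgetful.{u, v, w} k A
  jQ : forgetful.{u, v, w} k A ⟶ Q ⋙ forgetful.{u, v, w} k A
  compat : jQ ≫ Functor.whiskerRight l (forgetful k A) = jP ≫ Functor.whiskerLeft P X.prolongOne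

namespace JetStage

variable {X}

/-- The natural transformation `D̃_{J^n} ∘ J^1(l^{1,n}) : J^1 J^{n+1} ⟶ (Ω^1 ⋉ Ω^2) J^n`, whose
kernel is `J^{n+2}`. -/
def holonomy (D : JetStage.{u, v, w} X) : D.Q ⋙ X.jetOne ⟶ D.P ⋙ semiFunctor.{u, v, w} X :=
  Functor.whiskerRight D.l X.jetOne ≫ Functor.whiskerLeft D.P X.dTildeNat

theorem prolong_mem (D : JetStage.{u, v, w} X) (E : ModuleCat.{max u v} A) (e : E) :
    (D.holonomy.app E).hom (BalancedTensor.tmul A (JetAlg.mk X (1 ⊗ₜ 1))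
      (E := D.Q.obj E) ((D.jQ.app E).hom e)) = 0 := by
  have h := ConcreteCategory.congr_hom (NatTrans.congr_app D.compat E) e
  change (D.l.app E).hom ((D.jQ.app E).hom e) =
    BalancedTensor.tmul A (JetAlg.mk X (1 ⊗ₜ 1)) (E := D.P.obj E) ((D.jP.app E).hom e) at h
  change X.dTilde _ (BalancedTensor.tmul A (JetAlg.mk X (1 ⊗ₜ 1)) (E := X.jetOne.obj (D.P.obj E))
    ((D.l.app E).hom ((D.jQ.app E).hom e))) = 0
  rw [h]
  refine (X.dTilde_tmul (D.P.obj E) _ _ _).trans ?_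
  rw [← BalancedTensor.zero_tmul (A := A) (M := X.SemiForm)]
  congr 1
  ext
  · rw [JetAlg.one_dTildeAlg, mul_one, SemiForm.d_ι_one]; simp
  · rw [JetAlg.two_dTildeAlg, mul_one, SemiForm.d_ι_one]; simp

/-- The prolongation `j^{n+2}`, the corestriction of `j^1_{J^{n+1}} ∘ j^{n+1}`. -/
def prolongNext (D : JetStage.{u, v, w} X) :
    forgetful.{u, v, w} k A ⟶ kerFunctor D.holonomy ⋙ forgetful.{u, v, w} k A where
  app E := ModuleCat.ofHom
    (X := (forgetful.{u, v, w} k A).obj E)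
    (Y := (forgetful.{u, v, w} k A).obj ((kerFunctor D.holonomy).obj E))
    { toFun := fun e => (⟨((D.jQ ≫ Functor.whiskerLeft D.Q X.prolongOne).app E).hom e,
        D.prolong_mem E e⟩ : LinearMap.ker (D.holonomy.app E).hom)
      map_add' := fun e e' => Subtype.ext
        (map_add ((D.jQ ≫ Functor.whiskerLeft D.Q X.prolongOne).app E).hom e e')
      map_smul' := fun c e => Subtype.ext
        (map_smul ((D.jQ ≫ Functor.whiskerLeft D.Q X.prolongOne).app E).hom c e) }
  naturality E E' φ := by
    ext e
    exact Subtype.ext (ConcreteCategory.congr_hom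
      ((D.jQ ≫ Functor.whiskerLeft D.Q X.prolongOne).naturality φ) e)

/-- The step from `(J^n, J^{n+1})` to `(J^{n+1}, J^{n+2})`. -/
def next (D : JetStage.{u, v, w} X) : JetStage.{u, v, w} X where
  P := D.Q
  Q := kerFunctor D.holonomy
  l := kerInclusion D.holonomy
  jP := D.jQ
  jQ := D.prolongNext
  compat := rfl

variable (X) in
/-- The stage `(J^0, J^1) = (id, J^1)`, with `l^{1,0} = id` and `j^0 = id`. -/
def zero : JetStage.{u, v, w} X where
  P := 𝟭 _
  Q := X.jetOne
  l := 𝟙 X.jetOne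
  jP := 𝟙 (forgetful k A)
  jQ := X.prolongOne
  compat := rfl

end JetStage

/-- The pair `(J^n, J^{n+1})`. -/
def jetStage : ℕ → JetStage.{u, v, w} X
  | 0 => JetStage.zero X
  | n + 1 => (jetStage n).next

/-- The holonomic `n`-jet functor `J^n`: `J^0 = id`, `J^1 = J^1 A ⊗_A -`, and `J^{n+2}` is the
kernel of `D̃_{J^n} ∘ J^1(l^{1,n}) : J^1 J^{n+1} ⟶ (Ω^1 ⋉ Ω^2) J^n`. -/
def jet (n : ℕ) : ModuleCat.{max u v} A ⥤ ModuleCat.{max u v} A := (jetStage.{u, v, w} X n).P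

/-- The inclusion `l^{1,n} : J^{n+1} ⟶ J^1 J^n`. -/
def jetInclusion (n : ℕ) : jet.{u, v, w} X (n + 1) ⟶ jet.{u, v, w} X n ⋙ X.jetOne :=
  (jetStage X n).l

/-- The `n`-jet prolongation `j^n : id ⟶ J^n`. -/
def prolong (n : ℕ) : forgetful.{u, v, w} k A ⟶ jet.{u, v, w} X n ⋙ forgetful.{u, v, w} k A :=
  (jetStage X n).jP

theorem jet_zero : jet.{u, v, w} X 0 = 𝟭 _ := rfl

theorem jet_one : jet.{u, v, w} X 1 = X.jetOne := rfl

theorem jet_add_two (n : ℕ) : jet.{u, v, w} X (n + 2) =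
    kerFunctor (F := jet.{u, v, w} X (n + 1) ⋙ X.jetOne)
      (G := jet.{u, v, w} X n ⋙ X.semiFunctor)
      (Functor.whiskerRight (X.jetInclusion n) X.jetOne ≫
        Functor.whiskerLeft (jet.{u, v, w} X n) X.dTildeNat) := rfl

theorem prolong_zero : prolong.{u, v, w} X 0 = 𝟙 _ := rfl

theorem prolong_succ (n : ℕ) :
    prolong.{u, v, w} X (n + 1) ≫ Functor.whiskerRight (X.jetInclusion n) (forgetful k A) =
      prolong.{u, v, w} X n ≫ Functor.whiskerLeft (X.jet n) X.prolongOne :=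
  (jetStage X n).compat

/-! ### The Spencer operators and the Spencer sequence -/

/-- The functor `Ω^m J^n`, with values in `Mod_k`. -/
abbrev jetForm (n m : ℕ) : ModuleCat.{max u v} A ⥤ ModuleCat.{max u v} k :=
  (jet.{u, v, w} X n ⋙ X.formFunctor m) ⋙ forgetful.{u, v, w} k A

/-- The holonomic Spencer operator `S^{n+1,m} : Ω^m J^{n+1} ⟶ Ω^{m+1} J^n`: the composite of
`Ω^m(l^{1,n}) : Ω^m J^{n+1} ⟶ Ω^m J^1 J^n` with `S^{1,m}_{J^n}`, that is,
`ω ⊗ (∑_j [y_j ⊗ z_j] ⊗ ξ_j) ↦ ∑_j d(ω y_j) z_j ⊗ ξ_j`. -/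
def spencer (n m : ℕ) : jetForm.{u, v, w} X (n + 1) m ⟶ jetForm.{u, v, w} X n (m + 1) :=
  Functor.whiskerRight (Functor.whiskerRight (X.jetInclusion n) (X.formFunctor m))
      (forgetful k A) ≫
    Functor.whiskerLeft (X.jet n) (X.spencerOne m)

/-- The `n`-jet prolongation `j^n : id ⟶ Ω^0 J^n`, where `J^n` is identified with
`Ω^0 J^n = A ⊗_A J^n`. -/
def prolongForm (n : ℕ) : forgetful.{u, v, w} k A ⟶ jetForm.{u, v, w} X n 0 :=
  X.prolong n ≫ Functor.whiskerRight (Functor.whiskerLeft (X.jet n) X.toFormZero) (forgetful k A)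

/-- The objects of the sequence
`Ω^m J^n ⟶ Ω^{m+1} J^{n-1} ⟶ ⋯ ⟶ Ω^{m+n} J^0 ⟶ 0 ⟶ 0 ⟶ ⋯`; the `i`-th one is
`Ω^{m+i} J^{n-i}` for `i ≤ n`. -/
def spencerTail : (i n m : ℕ) → (ModuleCat.{max u v} A ⥤ ModuleCat.{max u v} k)
  | 0, n, m => jetForm.{u, v, w} X n m
  | _ + 1, 0, _ => (Functor.const _).obj (ModuleCat.of k PUnit)
  | i + 1, n + 1, m => spencerTail i n (m + 1)

/-- The maps of the sequence
`Ω^m J^n ⟶ Ω^{m+1} J^{n-1} ⟶ ⋯ ⟶ Ω^{m+n} J^0 ⟶ 0 ⟶ 0 ⟶ ⋯`. -/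
def spencerTailMap : (i n m : ℕ) →
    (spencerTail.{u, v, w} X i n m ⟶ spencerTail.{u, v, w} X (i + 1) n m)
  | 0, 0, _ => 0
  | 0, n + 1, m => X.spencer n m
  | _ + 1, 0, _ => 0
  | i + 1, n + 1, m => spencerTailMap i n (m + 1)

/-- The objects of the Spencer sequence
`id ⟶ J^n ⟶ Ω^1 J^{n-1} ⟶ ⋯ ⟶ Ω^{n-1} J^1 ⟶ Ω^n ⟶ 0`, continued by zeros. -/
def spencerSeq (n : ℕ) : ℕ → (ModuleCat.{max u v} A ⥤ ModuleCat.{max u v} k)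
  | 0 => forgetful.{u, v, w} k A
  | i + 1 => spencerTail.{u, v, w} X i n 0

/-- The maps of the Spencer sequence: the jet prolongation, followed by the Spencer operators. -/
def spencerSeqMap (n : ℕ) : (i : ℕ) →
    (spencerSeq.{u, v, w} X n i ⟶ spencerSeq.{u, v, w} X n (i + 1))
  | 0 => X.prolongForm n
  | i + 1 => X.spencerTailMap i n 0

end ExteriorCalculus

end

noncomputable section

namespace ExteriorCalculus

open BalancedTensor

variable {k : Type w} {A : Type u} [CommRing k] [Ring A] [Algebra k A] (X : ExteriorCalculus k A)

/-! The reason is that two consecutive Spencer operators see a jet only through `D̃`, and holonomic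
jets are cut out by the vanishing of `D̃`.

On generators, the composite of `S^{1,m}` and `S^{1,m+1}` sends `ω ⊗ [a ⊗ b] ⊗ [c ⊗ e] ⊗ ξ` to
`d(d(ω a) b c) e ⊗ ξ`. Since `d² = 0`, the Leibniz rule leaves `(-1)^{m+1} d(ω a) ∧ d(b c) e`, and
expanding `d(ω a) = dω a + (-1)^m ω ∧ da` turns this into `(-1)^{m+1} (dω ∧ (a d(b c) e) + (-1)^m ω
∧ (da ∧ d(b c) e))`. The two bracketed forms are exactly the components of `D̃([a ⊗ b] ⊗ [c ⊗ e])`.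
So for each `ω` the composite is a right linear contraction (`semiContract`) applied to `D̃`
(`spencerAlg_spencerAlg`, then `spencerOneHom_spencerOneHom` with coefficients in a module).

For the holonomic operators, each factor is an inclusion `l` followed by some `S^{1,m}`. Naturality
of `S^{1,m}` lets the second inclusion be applied before both operators, where it appears as
`J^1(l)`. The composite is then a contraction of `D̃ ∘ J^1(l)` on `J^{n+2}`, which is zero by the
definition of `J^{n+2}` as a kernel (`spencer_comp_spencer`).

At the left end, `l ∘ j^{n+1}` has values `[1 ⊗ 1] ⊗ j^n(ξ)`, and the Spencer operator
differentiates the unit: `d1 = 0` (`prolongForm_comp_spencer`). At the right end, the maps are zero.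
-/

/-! ### Contraction with `Ω^1 ⋉ Ω^2` and the factorization through `D̃` -/

theorem val_spencerAlg_mk_tmul {m : ℕ} (ω : X.Form m) (y z : A) :
    (X.spencerAlg m ω (JetAlg.mk X (y ⊗ₜ z))).val = X.d (ω.val * X.ι y) * X.ι z := rfl

/-- For `ω ∈ Ω^m`, the right `A`-linear map `Ω^1 ⋉ Ω^2 → Ω^{m+2}`,
`α + β ↦ (-1)^{m+1} (dω ∧ α + (-1)^m ω ∧ β)`. -/
def semiContract {m : ℕ} (ω : X.Form m) : X.SemiForm →ₗ[Aᵐᵒᵖ] X.Form (m + 1 + 1) where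
  toFun x := Form.mk X
    ((-1) ^ (m + 1) * (X.d ω.val * x.one.val + (-1) ^ m * (ω.val * x.two.val))) (by
      -- The signs are elements of the algebra `Ω`, not scalars, so stability of the degree under
      -- them is checked separately for `1` and `-1`.
      have hneg : ∀ (i : ℕ) {γ : X.Ω}, γ ∈ X.deg (m + 1 + 1) →
          (-1) ^ i * γ ∈ X.deg (m + 1 + 1) := by
        intro i γ h
        rcases neg_one_pow_eq_or X.Ω i with hi | hi
        · rwa [hi, one_mul]
        · rw [hi, neg_one_mul]; exact neg_mem h
      exact hneg _ (add_mem
        (SetLike.GradedMul.mul_mem (X.d_mem ω.val_mem) x.one.val_mem)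
        (hneg _ (SetLike.GradedMul.mul_mem (i := m) (j := 2) ω.val_mem x.two.val_mem))))
  map_add' x y := by
    ext
    simp only [map_add, Form.val_mk, Form.val_add, mul_add]
    abel
  map_smul' c x := by
    ext
    simp [mul_assoc, add_mul]

theorem val_semiContract {m : ℕ} (ω : X.Form m) (x : X.SemiForm) :
    (X.semiContract ω x).val =
      (-1) ^ (m + 1) * (X.d ω.val * x.one.val + (-1) ^ m * (ω.val * x.two.val)) := rfl

/-- The composite of two Spencer operators factors through `D̃`, at the level of `A`. -/
theorem spencerAlg_spencerAlg {m : ℕ} (ω : X.Form m) (x y : X.JetAlg) :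
    X.spencerAlg (m + 1) (X.spencerAlg m ω x) y =
      X.semiContract ω (JetAlg.dTildeAlg X x y) := by
  induction x using JetAlg.induction_on with
  | zero => simp
  | add x x' hx hx' =>
    rw [map_add, map_add, map_add, LinearMap.add_apply, LinearMap.add_apply, map_add, hx, hx']
  | mk a b =>
    induction y using JetAlg.induction_on with
    | zero => simp
    | add y y' hy hy' => rw [map_add, map_add, map_add, hy, hy']
    | mk c e =>
      ext
      rw [val_semiContract, JetAlg.one_dTildeAlg, JetAlg.two_dTildeAlg, val_spencerAlg_mk_tmul,
        val_spencerAlg_mk_tmul]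
      -- The sign in the Leibniz rule depends on the degree of the left factor: `d(ω a)` has degree
      -- `m + 1`, which produces the outer sign of `semiContract`.
      have hmem : X.d (ω.val * X.ι a) ∈ X.deg (m + 1) :=
        X.d_mem (by simpa using SetLike.GradedMul.mul_mem ω.val_mem (Form.ι_mem a))
      -- Regrouping treats `b c` as one element of `A`. The first Leibniz expansion then has only
      -- the term with `d(b c)` left, by `d² = 0`; the second splits `d(ω a)` into the parts that
      -- pair with the two components of `D̃`.
      rw [mul_assoc, ← map_mul, X.leibniz hmem, X.d_d, zero_mul, zero_add, X.leibniz ω.val_mem]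
      simp only [add_mul, mul_assoc]

/-- Both sides are additive in `t`, so the identity over `A` suffices. With `ω` held fixed, right
linearity of the contraction is enough to tensor it with `E`; its compatibility with the twisted
left action on `Ω^1 ⋉ Ω^2` is never needed. -/
theorem spencerOneHom_spencerOneHom (E : Type v) [AddCommGroup E] [Module A E] {m : ℕ}
    (ω : X.Form m) (t : BalancedTensor A X.JetAlg (BalancedTensor A X.JetAlg E)) :
    X.spencerOneHom E (m + 1) (X.spencerOneHom (BalancedTensor A X.JetAlg E) m (tmul A ω t)) =
      mapLeft E (X.semiContract ω) (X.dTilde E t) := by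
  induction t using BalancedTensor.induction_on with
  | zero => rw [BalancedTensor.tmul_zero]; simp only [map_zero]
  | add s t hs ht => rw [BalancedTensor.tmul_add]; simp only [map_add, hs, ht]
  | tmul x y =>
    induction y using BalancedTensor.induction_on with
    | zero => rw [BalancedTensor.tmul_zero, BalancedTensor.tmul_zero]; simp only [map_zero]
    | add y z hy hz => rw [BalancedTensor.tmul_add, BalancedTensor.tmul_add]; simp only [map_add, hy, hz]
    | tmul y e =>
      rw [spencerOneHom_tmul, spencerOneHom_tmul, dTilde_tmul, mapLeft_tmul,
        spencerAlg_spencerAlg]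

/-! ### Vanishing on holonomic jets -/

/-- Two Spencer operators compose to zero on `Ω^m G`, for any module `G` over `J^1 F` whose image
is killed by `D̃_E ∘ J^1(l)`. -/
theorem spencerOneHom_comp_eq_zero_of_dTilde {E F G : Type (max u v)}
    [AddCommGroup E] [Module A E] [AddCommGroup F] [Module A F] [AddCommGroup G] [Module A G]
    (l : F →ₗ[A] BalancedTensor A X.JetAlg E) (l' : G →ₗ[A] BalancedTensor A X.JetAlg F)
    (h : ∀ x, X.dTilde E (mapRight A X.JetAlg l (l' x)) = 0) {m : ℕ}
    (t : BalancedTensor A (X.Form m) G) :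
    X.spencerOneHom E (m + 1) (mapRight A _ l (X.spencerOneHom F m (mapRight A _ l' t))) = 0 := by
  induction t using BalancedTensor.induction_on with
  | zero => simp only [map_zero]
  | tmul ω x =>
    -- Naturality carries `l` across the inner Spencer operator, so that both operators act on `ω ⊗
    -- J^1(l)(l' x)` and the factorization through `D̃` applies.
    rw [mapRight_tmul, ← spencerOneHom_naturality.{u, max u v, w}, mapRight_tmul,
      spencerOneHom_spencerOneHom, h, map_zero]
  | add s t hs ht => rw [map_add, map_add, map_add, map_add, hs, ht, add_zero]

theorem spencer_comp_spencer (n m : ℕ) :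
    spencer.{u, v, w} X (n + 1) m ≫ spencer.{u, v, w} X n (m + 1) = 0 := by
  ext E t
  -- An element of `J^{n+2}` is by construction an element of `J^1 J^{n+1}` with a proof that `D̃ ∘
  -- J^1(l)` kills it; that proof is `x.2`.
  exact X.spencerOneHom_comp_eq_zero_of_dTilde.{u, v, w} ((X.jetInclusion n).app E).hom
    ((X.jetInclusion (n + 1)).app E).hom (fun x => x.2) t

/-! ### The Spencer operator on prolongations -/

/-- The value is `d(1 · 1) · 1`, and `d1 = 0` by the Leibniz rule. -/
theorem spencerAlg_ofA_one_mk_one :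
    X.spencerAlg 0 (X.ofA 1) (JetAlg.mk X (1 ⊗ₜ 1)) = 0 := by
  ext
  rw [val_spencerAlg_mk_tmul, val_ofA, ← map_mul, mul_one, SemiForm.d_ι_one, zero_mul,
    Form.val_zero]

theorem spencerOneHom_ofA_one_tmul_mk_one (E : Type v) [AddCommGroup E] [Module A E] (e : E) :
    X.spencerOneHom E 0 (tmul A (X.ofA 1) (tmul A (JetAlg.mk X (1 ⊗ₜ 1)) e)) = 0 := by
  rw [spencerOneHom_tmul, spencerAlg_ofA_one_mk_one, BalancedTensor.zero_tmul]

theorem prolongForm_comp_spencer (n : ℕ) :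
    prolongForm.{u, v, w} X (n + 1) ≫ spencer.{u, v, w} X n 0 = 0 := by
  ext E e
  -- The identification of `J^{n+1}` with `Ω^0 J^{n+1}` is `ξ ↦ 1 ⊗ ξ`, so the form fed to the
  -- operator is the unit.
  change X.spencerOneHom ((jet.{u, v, w} X n).obj E) 0
    (tmul A (X.ofA 1) (((X.jetInclusion n).app E).hom (((X.prolong (n + 1)).app E).hom e))) = 0
  have h : ((X.jetInclusion n).app E).hom (((X.prolong (n + 1)).app E).hom e) =
      tmul A (JetAlg.mk X (1 ⊗ₜ 1)) (E := (jet.{u, v, w} X n).obj E)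
        (((X.prolong n).app E).hom e) :=
    ConcreteCategory.congr_hom (NatTrans.congr_app (X.prolong_succ n) E) e
  rw [h]
  exact X.spencerOneHom_ofA_one_tmul_mk_one _ _

/-! ### Assembly of the complex -/

/-- Moving one place along the sequence replaces `(n, m)` by `(n - 1, m + 1)`, so every composite
reduces either to one at the head of a shorter sequence or to one in the zero part. -/
theorem spencerTailMap_comp : ∀ i n m : ℕ,
    spencerTailMap.{u, v, w} X i n m ≫ spencerTailMap.{u, v, w} X (i + 1) n m = 0
  | 0, 0, _ => Limits.zero_comp
  -- Here `S^{1,m}` already lands in the last term `Ω^{m+1} J^0`, and the next map is the zero map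
  -- out of it.
  | 0, 1, _ => Limits.comp_zero
  | 0, n + 2, m => X.spencer_comp_spencer n m
  | _ + 1, 0, _ => Limits.zero_comp
  | i + 1, n + 1, m => spencerTailMap_comp i n (m + 1)

theorem spencerSeqMap_comp (n : ℕ) : ∀ i : ℕ,
    spencerSeqMap.{u, v, w} X n i ≫ spencerSeqMap.{u, v, w} X n (i + 1) = 0
  | 0 => by
    cases n with
    -- For `n = 0` no Spencer operator occurs: the sequence is `id ⟶ Ω^0 J^0 ⟶ 0`.
    | zero => exact Limits.comp_zero
    | succ n => exact X.prolongForm_comp_spencer n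
  | i + 1 => X.spencerTailMap_comp i n 0

end ExteriorCalculus

end

theorem theorem3p16 {k : Type w} {A : Type u} [CommRing k] [Ring A] [Algebra k A]
    (X : ExteriorCalculus k A) :
    -- the Spencer sequence is a complex, for every `n`
    (∀ n i : ℕ, ExteriorCalculus.spencerSeqMap.{u, v, w} X n i ≫
      ExteriorCalculus.spencerSeqMap.{u, v, w} X n (i + 1) = 0) ∧
    -- `S^{n+1,0} ∘ j^{n+1} = 0`
    (∀ n : ℕ, ExteriorCalculus.prolongForm.{u, v, w} X (n + 1) ≫
      ExteriorCalculus.spencer.{u, v, w} X n 0 = 0) ∧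
    -- `S^{n+1,m+1} ∘ S^{n+2,m} = 0`
    (∀ n m : ℕ, ExteriorCalculus.spencer.{u, v, w} X (n + 1) m ≫
      ExteriorCalculus.spencer.{u, v, w} X n (m + 1) = 0) :=
  ⟨X.spencerSeqMap_comp, X.prolongForm_comp_spencer, X.spencer_comp_spencer⟩
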